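/- Let $b>0$ and let $K_0:(0,\infty)\to\mathbb{R}$ be a smooth function satisfying: (A1) $-K_0'$ is a nonzero completely monotone function with representing measure $\mu$: there is a nonzero non-negative Borel measure $\mu$ on $[0,\infty)$ such that $$-K_0'(t)=\int_0^\infty e^{-tx}\,\mathrm{d}\mu(x)\qquad\text{for all } t>0;$$ (A2) there exist $a_0>0$ and $\alpha\in(0,1)$ such that $\displaystyle\int_0^{a_0}|K_0(t)|\,t^{-\alpha+\alpha^2}\,\mathrm{d}t<\infty$. For $n\in\mathbb{N}^\star=\{1,2,\dots\}$ put, with $\int_{\mathbb{T}}\mathrm{d}\eta=\int_0^{2\pi}\mathrm{d}\eta$, $$\lambda_{n,b}=\int_{\mathbb{T}}K_0\big(2b|\sin\tfrac{\eta}{2}|\big)\cos(n\eta)\,\mathrm{d}\eta,\qquad \Omega^0_{n,b}=\int_{\mathbb{T}}K_0\big(2b|\sin\tfrac{\eta}{2}|\big)\cos\eta\,\mathrm{d}\eta-\int_{\mathbb{T}}K_0\big(2b|\sin\tfrac{\eta}{2}|\big)\cos(n\eta)\,\mathrm{d}\eta .$$ Integrals $\int_0^\infty\cdots\mathrm{d}\mu(x)$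 are over $[0,\infty)$, including a possible atom at $0$. Then $\eta\mapsto K_0(2b|\sin\frac{\eta}{2}|)$ is integrable on $\mathbb{T}$, all the $\mu$-integrals below are finite, and the following hold. (1) For every $n\in\mathbb{N}^\star$, $$\lambda_{1,b}-\frac{8n^2}{4n^2-1}\int_0^\infty\frac{b}{n^2+(bx)^2}\,\mathrm{d}\mu(x)\;\le\;\Omega^0_{n,b}\;\le\;\lambda_{1,b}-\frac{8n^2}{4n^2+1}\int_0^\infty\frac{b}{n^2+(bx)^2}\,\mathrm{d}\mu(x),$$ and $$\lim_{n\to\infty}\Omega^0_{n,b}=\int_{\mathbb{T}}K_0\big(2b|\sin\tfrac{\eta}{2}|\big)\cos\eta\,\mathrm{d}\eta .$$ (2) The map $n\in\mathbb{N}^\star\mapsto\Omega^0_{n,b}$ is strictly increasing, and for every $n\in\mathbb{N}^\star$ $$\tfrac12D_n\le\Omega^0_{n+1,b}-\Omega^0_{n,b}\le4D_n,\qquad D_n=\int_0^\infty\frac{b}{n^2+(bx)^2}\,\frac{2n+1}{(n+1)^2+(bx)^2}\,\mathrm{d}\mu(x).$$ (3) There is a constant $c>0$ such that $\Omega^0_{n+1,b}-\Omega^0_{n,b}\ge\dfrac{c}{n^3}$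 for all $n\in\mathbb{N}^\star$. Moreover, for all $d\ge 0$ and $m>0$ the constant can be chosen depending only on $m$, $d$ and $b$, uniformly over all $K_0$ and $\mu$ as above with $\mu([0,d])\ge m$. -/

import Mathlib

open Real Set Filter Topology MeasureTheory
open scoped NNReal ContDiff

noncomputable section

/-- `-K₀'` is a nonzero completely monotone function with representing measure `μ`:
`K₀` is smooth on `(0, ∞)` and `-K₀'(t) = ∫_{[0, ∞)} e^{-t x} dμ(x)` (a convergent integral) for all
`t > 0`, where `μ` is a nonzero non-negative Borel measure on `[0, ∞)`.
An atom of `μ` at `0` is allowed. -/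
structure IsLaplaceKernel (K₀ : ℝ → ℝ) (μ : Measure ℝ≥0) : Prop where
  smooth : ContDiffOn ℝ ∞ K₀ (Ioi 0)
  measure_ne_zero : μ ≠ 0
  integrable_exp : ∀ t : ℝ, 0 < t → Integrable (fun x : ℝ≥0 => Real.exp (-(t * (x : ℝ)))) μ
  neg_deriv_eq : ∀ t : ℝ, 0 < t → -deriv K₀ t = ∫ x : ℝ≥0, Real.exp (-(t * (x : ℝ))) ∂μ

/-- For some `a₀ > 0` and `α ∈ (0, 1)`, the integral of `|K₀(t)| t^{-α + α²}` over `(0, a₀)`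
is finite. -/
def IsIntegrableNearZero (K₀ : ℝ → ℝ) : Prop :=
  ∃ a₀ : ℝ, 0 < a₀ ∧ ∃ α : ℝ, 0 < α ∧ α < 1 ∧
    IntegrableOn (fun t : ℝ => |K₀ t| * t ^ (-α + α ^ 2)) (Ioo 0 a₀)

/-- `λ_{n,b} = ∫_𝕋 K₀(|b - b e^{iη}|) cos(nη) dη`, where `|b - b e^{iη}| = 2 b |sin(η/2)|` and the
integral is over one period with respect to the (unnormalized) Lebesgue measure. -/
def kernelEigenvalue (K₀ : ℝ → ℝ) (b : ℝ) (n : ℕ) : ℝ :=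
  ∫ η in (0 : ℝ)..(2 * π), K₀ (2 * b * |Real.sin (η / 2)|) * Real.cos (n * η)

/-- `Ω⁰_{n,b} = ∫_𝕋 K₀(2b|sin(η/2)|) cos η dη - ∫_𝕋 K₀(2b|sin(η/2)|) cos(nη) dη`. -/
def angularVelocity (K₀ : ℝ → ℝ) (b : ℝ) (n : ℕ) : ℝ :=
  (∫ η in (0 : ℝ)..(2 * π), K₀ (2 * b * |Real.sin (η / 2)|) * Real.cos η) -
    ∫ η in (0 : ℝ)..(2 * π), K₀ (2 * b * |Real.sin (η / 2)|) * Real.cos (n * η)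

/-- The integrand `b / (n² + (b x)²)`. -/
def boundDensity (b : ℝ) (n : ℕ) (x : ℝ≥0) : ℝ :=
  b / ((n : ℝ) ^ 2 + (b * (x : ℝ)) ^ 2)

/-- The integrand of `D_n`: `b / (n² + (b x)²) * ((2n + 1) / ((n + 1)² + (b x)²))`. -/
def gapDensity (b : ℝ) (n : ℕ) (x : ℝ≥0) : ℝ :=
  b / ((n : ℝ) ^ 2 + (b * (x : ℝ)) ^ 2) *
    ((2 * (n : ℝ) + 1) / (((n : ℝ) + 1) ^ 2 + (b * (x : ℝ)) ^ 2))

/-- `D_n`, the integral over `[0, ∞)` of `gapDensity b n` with respect to `μ`. -/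
def gapIntegral (μ : Measure ℝ≥0) (b : ℝ) (n : ℕ) : ℝ :=
  ∫ x : ℝ≥0, gapDensity b n x ∂μ

end

/-! Everything reduces to pointwise bounds on a density against `μ`. Writing `K₀(t) - K₀(2b)` as a
superposition of `∫_t^{2b} e^{-rx} dr` over `μ`, then using Fubini and an integration by parts,
gives `λ_n = ∫ eigenDensity b n dμ` (`kernelEigenvalue_eq_integral`), where for `x > 0` the density
is `(2/x) A_n(2bx)` with `A_n = angerCos n`.

With `N = 4n²`, `A_n` solves `z²A'' + zA' = (z² + N)A - 2z`. Dropping the derivatives leaves `2w_N`,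
where `w_N = z/(z² + N)` is `barrier N`. The error `z²w'' + zw' = z · barrierSymbol N (z²)` is at
most `z/N` in size, so suitable multiples of `w_N` are super- and subsolutions, and the maximum
principle `nonpos_of_elliptic` traps `A_n` between them. This is (1).

For (2), put `M = 4(n+1)²` and `L = z²∂² + z∂ - (z² + N)`. The source `2z` cancels and `L(A_n -
A_{n+1}) = -(M - N)A_{n+1}`. Since `L(w_N - w_M)` is `-(M - N)w_M` plus a controlled error, the
bounds on `A_{n+1}` make `(w_N - w_M)/2` and `4(w_N - w_M)` barriers for the difference. After
scaling, `w_N - w_M` becomes the integrand of `D_n`, and restricting to `x ≤ d` gives (3). -/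

/-! ### Regularity and decay of the sine-Laplace transform -/

/-- The transform `z ↦ ∫₀^π φ(s) e^{-z sin s} ds`. -/
noncomputable def sinLaplace (φ : ℝ → ℝ) (z : ℝ) : ℝ :=
  ∫ s in (0 : ℝ)..π, φ s * Real.exp (-(z * Real.sin s))

/-- Differentiation only multiplies `φ` by `-sin s`, so the class of transforms is stable and the
lemma can be iterated to reach second derivatives. -/
theorem hasDerivAt_sinLaplace {φ : ℝ → ℝ} (hφ : Continuous φ) (z : ℝ) :
    HasDerivAt (sinLaplace φ) (sinLaplace (fun s => -(Real.sin s * φ s)) z) z := by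
  refine (intervalIntegral.hasDerivAt_integral_of_dominated_loc_of_deriv_le
    (F := fun z s => φ s * Real.exp (-(z * Real.sin s)))
    (F' := fun z s => -(Real.sin s * φ s) * Real.exp (-(z * Real.sin s)))
    (bound := fun s => |φ s| * Real.exp (|z| + 1))
    (Metric.ball_mem_nhds z one_pos) ?_ ?_ ?_ ?_ ?_ ?_).2
  · exact Eventually.of_forall fun y => (by fun_prop : Continuous _).aestronglyMeasurable
  · exact (by fun_prop : Continuous _).intervalIntegrable _ _
  · exact (by fun_prop : Continuous _).aestronglyMeasurable
  · refine Eventually.of_forall fun s _ y hy => ?_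
    rw [norm_mul, norm_neg, norm_mul, Real.norm_eq_abs, Real.norm_eq_abs, Real.norm_eq_abs,
      Real.abs_exp]
    have h1 : |Real.sin s| ≤ 1 := Real.abs_sin_le_one s
    have h2 : |y| ≤ |z| + 1 := by
      rw [Metric.mem_ball, Real.dist_eq] at hy
      have := abs_sub_abs_le_abs_sub y z
      linarith
    have h3 : -(y * Real.sin s) ≤ |z| + 1 := by
      calc -(y * Real.sin s) ≤ |y * Real.sin s| := neg_le_abs _
        _ = |y| * |Real.sin s| := abs_mul _ _
        _ ≤ |y| * 1 := by gcongr
        _ ≤ |z| + 1 := by linarith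
    calc |Real.sin s| * |φ s| * Real.exp (-(y * Real.sin s))
        ≤ 1 * |φ s| * Real.exp (|z| + 1) := by gcongr
      _ = |φ s| * Real.exp (|z| + 1) := by ring
  · exact (by fun_prop : Continuous _).intervalIntegrable _ _
  · refine Eventually.of_forall fun s _ y _ => ?_
    have := (((hasDerivAt_id y).mul_const (Real.sin s)).neg.exp).const_mul (φ s)
    exact this.congr_deriv (by simp only [Pi.neg_apply, id]; ring)

theorem continuous_sinLaplace {φ : ℝ → ℝ} (hφ : Continuous φ) : Continuous (sinLaplace φ) :=
  continuous_iff_continuousAt.2 fun z => (hasDerivAt_sinLaplace hφ z).continuousAt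

theorem tendsto_sinLaplace_atTop {φ : ℝ → ℝ} (hφ : Continuous φ) :
    Tendsto (sinLaplace φ) atTop (𝓝 0) := by
  have h : Tendsto (sinLaplace φ) atTop (𝓝 (∫ s in (0 : ℝ)..π, (0 : ℝ))) := by
    refine intervalIntegral.tendsto_integral_filter_of_dominated_convergence
      (fun s => |φ s|) ?_ ?_ ?_ ?_
    · exact Eventually.of_forall fun y => (by fun_prop : Continuous _).aestronglyMeasurable
    · filter_upwards [eventually_ge_atTop (0 : ℝ)] with z hz
      refine Eventually.of_forall fun s hs => ?_
      rw [uIoc_of_le pi_pos.le] at hs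
      rw [norm_mul, Real.norm_eq_abs, Real.norm_eq_abs, Real.abs_exp]
      have : Real.exp (-(z * Real.sin s)) ≤ 1 :=
        Real.exp_le_one_iff.2 (neg_nonpos.2 (mul_nonneg hz
          (Real.sin_nonneg_of_nonneg_of_le_pi hs.1.le hs.2)))
      exact mul_le_of_le_one_right (abs_nonneg _) this
    · exact (by fun_prop : Continuous _).intervalIntegrable _ _
    -- The exponential decays only where `sin s > 0`; the endpoint `π` is a null set, and `0`
    -- already lies outside the half-open interval.
    · have : ∀ᵐ s : ℝ, s ≠ π := by simp [ae_iff]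
      filter_upwards [this] with s hsπ hs
      rw [uIoc_of_le pi_pos.le] at hs
      have hpos : 0 < Real.sin s := Real.sin_pos_of_pos_of_lt_pi hs.1 (lt_of_le_of_ne hs.2 hsπ)
      have := (Real.tendsto_exp_neg_atTop_nhds_zero.comp
        (tendsto_id.atTop_mul_const hpos)).const_mul (φ s)
      simpa using this
  simpa using h

/-! ### Maximum principle -/

/-- A weak maximum principle on `(0, ∞)`. -/
theorem nonpos_of_elliptic {f f' f'' q : ℝ → ℝ}
    (hc : ContinuousOn f (Ici 0)) (h0 : f 0 ≤ 0) (htop : Tendsto f atTop (𝓝 0))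
    (hf : ∀ z, 0 < z → HasDerivAt f (f' z) z) (hf' : ∀ z, 0 < z → HasDerivAt f' (f'' z) z)
    (hq : ∀ z, 0 < z → 0 < q z)
    (hL : ∀ z, 0 < z → q z * f z ≤ z ^ 2 * f'' z + z * f' z) {z : ℝ} (hz : 0 ≤ z) : f z ≤ 0 := by
  by_contra! hpos
  obtain ⟨R, hR⟩ := (htop.eventually (gt_mem_nhds hpos)).exists_forall_of_atTop
  obtain ⟨x, hx, hmax⟩ := isCompact_Icc.exists_isMaxOn (s := Icc 0 (max R z))
    ⟨z, hz, le_max_right _ _⟩ (hc.mono fun y hy => hy.1)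
  have hzx : f z ≤ f x := hmax ⟨hz, le_max_right _ _⟩
  have hx0 : 0 < x := by
    rcases hx.1.eq_or_lt with h | h
    · rw [← h] at hzx; linarith
    · exact h
  have hglob : ∀ y, 0 ≤ y → f y ≤ f x := fun y hy => by
    rcases le_total y (max R z) with h | h
    · exact hmax ⟨hy, h⟩
    · exact (hR y ((le_max_left _ _).trans h)).le.trans hzx
  have hloc : IsLocalMax f x := by
    filter_upwards [lt_mem_nhds hx0] with y hy using hglob y hy.le
  have hd : f' x = 0 := hloc.hasDerivAt_eq_zero (hf x hx0)
  have hdd : 0 < f'' x := by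
    have h1 := hL x hx0
    have h2 := mul_pos (hq x hx0) (hpos.trans_le hzx)
    rw [hd] at h1
    have : 0 < x ^ 2 * f'' x := by linarith
    exact pos_of_mul_pos_right this (by positivity)
  have hev : deriv f =ᶠ[𝓝 x] f' := by
    filter_upwards [lt_mem_nhds hx0] with y hy using (hf y hy).deriv
  -- At a positive maximum the inequality forces `f'' x > 0`, so `x` is also a local minimum; `f` is
  -- then locally constant, which contradicts `f'' x > 0`.
  have hmin : IsLocalMin f x := isLocalMin_of_deriv_deriv_pos
    (by rw [hev.deriv_eq, (hf' x hx0).deriv]; exact hdd) (by rw [(hf x hx0).deriv, hd])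
    (hf x hx0).continuousAt
  have hconst : f =ᶠ[𝓝 x] fun _ => f x := by
    filter_upwards [hloc, hmin] with y h1 h2 using le_antisymm h1 h2
  have hf'0 : f' =ᶠ[𝓝 x] fun _ => 0 := by
    filter_upwards [hconst.eventuallyEq_nhds, lt_mem_nhds hx0] with y hy hy0
    rw [← (hf y hy0).deriv, hy.deriv_eq, deriv_const]
  have := (hf' x hx0).deriv
  rw [hf'0.deriv_eq, deriv_const] at this
  linarith

/-! ### Anger-type integrals and their differential equation -/

/-- The Anger-type integral `∫₀^π cos(2ns) e^{-z sin s} ds`. -/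
noncomputable def angerCos (n : ℕ) : ℝ → ℝ := sinLaplace fun s => Real.cos (2 * n * s)

/-- The integral `∫₀^π cos s sin(2ns) e^{-z sin s} ds`. -/
noncomputable def angerSin (n : ℕ) : ℝ → ℝ :=
  sinLaplace fun s => Real.cos s * Real.sin (2 * n * s)

theorem hasDerivAt_exp_sin (z s : ℝ) : HasDerivAt (fun s => Real.exp (-(z * Real.sin s)))
    (-(z * Real.cos s) * Real.exp (-(z * Real.sin s))) s := by
  have := ((Real.hasDerivAt_sin s).const_mul z).neg.exp
  exact this.congr_deriv (by simp only [Pi.neg_apply]; ring)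

theorem hasDerivAt_cos_mul (c s : ℝ) :
    HasDerivAt (fun s => Real.cos (c * s)) (-(c * Real.sin (c * s))) s := by
  have := (((hasDerivAt_id s).const_mul c)).cos
  exact this.congr_deriv (by simp only [id]; ring)

theorem hasDerivAt_sin_mul (c s : ℝ) :
    HasDerivAt (fun s => Real.sin (c * s)) (c * Real.cos (c * s)) s := by
  have := (((hasDerivAt_id s).const_mul c)).sin
  exact this.congr_deriv (by simp only [id]; ring)

theorem cos_two_nat_mul_pi (n : ℕ) : Real.cos (2 * n * π) = 1 := by
  rw [show (2 * n * π : ℝ) = n * (2 * π) by ring]; exact Real.cos_nat_mul_two_pi n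

theorem sin_two_nat_mul_pi (n : ℕ) : Real.sin (2 * n * π) = 0 := by
  have := Real.sin_nat_mul_pi (2 * n)
  push_cast at this; exact this

/-- Integrate the derivative of `sin(2ns) e^{-z sin s}`, which vanishes at both ends. For `n ≥ 1`
this makes `angerSin` the continuous extension to `z = 0` of a multiple of `angerCos n z / z`. -/
theorem mul_angerSin (n : ℕ) (z : ℝ) : z * angerSin n z = 2 * n * angerCos n z := by
  have h := intervalIntegral.integral_eq_sub_of_hasDerivAt (a := 0) (b := π)
    (f := fun s => Real.sin (2 * n * s) * Real.exp (-(z * Real.sin s)))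
    (fun s _ => (hasDerivAt_sin_mul (2 * n) s).mul (hasDerivAt_exp_sin z s))
    ((by fun_prop : Continuous _).intervalIntegrable _ _)
  rw [sin_two_nat_mul_pi] at h
  simp only [angerSin, angerCos, sinLaplace]
  rw [← intervalIntegral.integral_const_mul, ← intervalIntegral.integral_const_mul, ← sub_eq_zero,
    ← neg_eq_zero, ← intervalIntegral.integral_sub
      ((by fun_prop : Continuous _).intervalIntegrable _ _)
      ((by fun_prop : Continuous _).intervalIntegrable _ _), ← intervalIntegral.integral_neg]
  convert h using 1
  · congr 1; ext s; ring
  · simp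

/-- `angerCos` solves an inhomogeneous modified Bessel equation. -/
theorem exists_angerCos_ode (n : ℕ) : ∃ f' f'' : ℝ → ℝ,
    (∀ z, HasDerivAt (angerCos n) (f' z) z) ∧ (∀ z, HasDerivAt f' (f'' z) z) ∧
    ∀ z, z ^ 2 * f'' z + z * f' z = (z ^ 2 + 4 * n ^ 2) * angerCos n z - 2 * z := by
  refine ⟨_, _, fun z => hasDerivAt_sinLaplace (by fun_prop) z,
    fun z => hasDerivAt_sinLaplace (by fun_prop) z, fun z => ?_⟩
  -- An explicit primitive, modulo `sin² + cos² = 1`, of the integrand of the homogeneous Bessel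
  -- operator; its boundary values `-z` at `π` and `z` at `0` give the source `-2z`.
  have h := intervalIntegral.integral_eq_sub_of_hasDerivAt (a := 0) (b := π)
    (f := fun s => (z * (Real.cos s * Real.cos (2 * n * s)) - 2 * n * Real.sin (2 * n * s)) *
      Real.exp (-(z * Real.sin s)))
    (fun s _ => (((((Real.hasDerivAt_cos s).mul (hasDerivAt_cos_mul (2 * n) s)).const_mul z).sub
      ((hasDerivAt_sin_mul (2 * n) s).const_mul (2 * n : ℝ))).mul (hasDerivAt_exp_sin z s)))
    ((by fun_prop : Continuous _).intervalIntegrable _ _)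
  rw [sin_two_nat_mul_pi, cos_two_nat_mul_pi] at h
  simp only [angerCos, sinLaplace]
  rw [← sub_eq_zero, ← intervalIntegral.integral_const_mul, ← intervalIntegral.integral_const_mul,
    ← intervalIntegral.integral_const_mul, ← intervalIntegral.integral_add
      ((by fun_prop : Continuous _).intervalIntegrable _ _)
      ((by fun_prop : Continuous _).intervalIntegrable _ _), ← sub_add, 
    ← intervalIntegral.integral_sub
      ((by fun_prop : Continuous _).intervalIntegrable _ _)
      ((by fun_prop : Continuous _).intervalIntegrable _ _)]
  rw [← eq_neg_iff_add_eq_zero]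
  refine Eq.trans ?_ (h.trans ?_)
  · congr 1; ext s
    simp only [Pi.mul_apply, Pi.sub_apply]
    have : Real.sin s ^ 2 = 1 - Real.cos s ^ 2 := Real.sin_sq s
    linear_combination (z ^ 2 * Real.cos (2 * n * s) * Real.exp (-(z * Real.sin s))) * this
  · simp; ring

/-! ### The barrier and its error term -/

/-- The barrier `z / (z² + N)`. -/
noncomputable def barrier (N z : ℝ) : ℝ := z / (z ^ 2 + N)

theorem continuous_barrier {N : ℝ} (hN : 0 < N) : Continuous (barrier N) :=
  continuous_id.div (by fun_prop) fun z => by positivity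

theorem tendsto_barrier_atTop {N : ℝ} (hN : 0 < N) : Tendsto (barrier N) atTop (𝓝 0) := by
  refine squeeze_zero' ?_ ?_ tendsto_inv_atTop_zero
  · filter_upwards [eventually_gt_atTop (0 : ℝ)] with z hz
    rw [barrier]; positivity
  · filter_upwards [eventually_gt_atTop (0 : ℝ)] with z hz
    rw [barrier, inv_eq_one_div, div_le_div_iff₀ (by positivity) hz]
    nlinarith

theorem hasDerivAt_barrier {N : ℝ} (hN : 0 < N) (z : ℝ) :
    HasDerivAt (barrier N) ((N - z ^ 2) / (z ^ 2 + N) ^ 2) z := by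
  have hP : z ^ 2 + N ≠ 0 := by positivity
  refine ((hasDerivAt_id z).div ((hasDerivAt_pow 2 z).add_const N) hP).congr_deriv ?_
  simp only [id]
  field_simp
  push_cast; ring

theorem hasDerivAt_deriv_barrier {N : ℝ} (hN : 0 < N) (z : ℝ) :
    HasDerivAt (fun z => (N - z ^ 2) / (z ^ 2 + N) ^ 2)
      (2 * z * (z ^ 2 - 3 * N) / (z ^ 2 + N) ^ 3) z := by
  have hP : z ^ 2 + N ≠ 0 := by positivity
  refine (((hasDerivAt_pow 2 z).const_sub N).div (((hasDerivAt_pow 2 z).add_const N).pow 2)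
    (pow_ne_zero 2 hP)).congr_deriv ?_
  simp only [Pi.pow_apply]
  field_simp
  push_cast; ring

/-- The Euler operator `(z∂)²` applied to the barrier, divided by `z`, as a function of `u = z²`. -/
noncomputable def barrierSymbol (N u : ℝ) : ℝ := 1 / (u + N) - 8 * N * u / (u + N) ^ 3

theorem euler_barrier {N : ℝ} (hN : 0 < N) (z : ℝ) :
    z ^ 2 * (2 * z * (z ^ 2 - 3 * N) / (z ^ 2 + N) ^ 3) + z * ((N - z ^ 2) / (z ^ 2 + N) ^ 2) =
      z * barrierSymbol N (z ^ 2) := by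
  have hP : z ^ 2 + N ≠ 0 := by positivity
  rw [barrierSymbol]
  field_simp
  ring

theorem mul_barrier {N : ℝ} (hN : 0 < N) (z : ℝ) : (z ^ 2 + N) * barrier N z = z := by
  rw [barrier]
  exact mul_div_cancel₀ _ (by positivity)

theorem barrierSymbol_le {N u : ℝ} (hN : 0 < N) (hu : 0 ≤ u) : barrierSymbol N u ≤ 1 / N := by
  have h1 : 0 ≤ 8 * N * u / (u + N) ^ 3 := by positivity
  have h2 : 1 / (u + N) ≤ 1 / N := one_div_le_one_div_of_le hN (by linarith)
  rw [barrierSymbol]; linarith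

theorem le_barrierSymbol {N u : ℝ} (hN : 0 < N) (hu : 0 ≤ u) : -(1 / N) ≤ barrierSymbol N u := by
  have h : barrierSymbol N u + 1 / N =
      (u ^ 3 + 4 * N * u ^ 2 - 3 * N ^ 2 * u + 2 * N ^ 3) / (N * (u + N) ^ 3) := by
    have : u + N ≠ 0 := by positivity
    rw [barrierSymbol]; field_simp; ring
  have h2 : 0 ≤ u ^ 3 + 4 * N * u ^ 2 - 3 * N ^ 2 * u + 2 * N ^ 3 := by
    -- This square absorbs the negative term of the cubic; what remains is `u³ + N³/4`.
    have : 0 ≤ N * (3 * (u - N / 2) ^ 2 + u ^ 2 + N ^ 2) := by positivity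
    nlinarith [pow_nonneg hu 3, pow_pos hN 3]
  have : 0 ≤ barrierSymbol N u + 1 / N := by rw [h]; positivity
  linarith

theorem mul_le_add_sq_div_four (N u : ℝ) : u * N ≤ (u + N) ^ 2 / 4 := by
  nlinarith [sq_nonneg (u - N)]

/-- The two parts of the symbol contribute `1/4` and `1/8` times `(M - N)/(u + M)`, hence `3/2`
after the factor 4. The weaker `28/15` is the allowance left in `angerCos_sub_le`. -/
theorem barrierSymbol_sub_le {N M u : ℝ} (hN : 4 ≤ N) (hM : 16 ≤ M) (hNM : N ≤ M) (hu : 0 ≤ u) :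
    4 * (barrierSymbol N u - barrierSymbol M u) ≤ 28 / 15 * ((M - N) / (u + M)) := by
  have hP : 0 < u + N := by linarith
  have hP' : 0 < u + M := by linarith
  have hΔ : 0 ≤ (M - N) / (u + M) := div_nonneg (by linarith) hP'.le
  have e1 : 1 / (u + N) - 1 / (u + M) = (M - N) / (u + M) * (1 / (u + N)) := by
    field_simp; ring
  have b1 : (M - N) / (u + M) * (1 / (u + N)) ≤ (M - N) / (u + M) * (1 / 4) := by
    gcongr; linarith
  have b2 : 8 * N * u / (u + M) ^ 3 ≤ 8 * N * u / (u + N) ^ 3 := by gcongr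
  have e2 : 8 * M * u / (u + M) ^ 3 - 8 * N * u / (u + M) ^ 3 =
      (M - N) / (u + M) * (8 * (u / (u + M) ^ 2)) := by
    field_simp
  have b3 : u / (u + M) ^ 2 ≤ 1 / 64 := by
    rw [div_le_div_iff₀ (by positivity) (by norm_num)]
    nlinarith [sq_nonneg (u - M)]
  have b4 : (M - N) / (u + M) * (8 * (u / (u + M) ^ 2)) ≤ (M - N) / (u + M) * (8 * (1 / 64)) := by
    gcongr
  simp only [barrierSymbol]
  linarith

theorem le_barrierSymbol_sub {N M u : ℝ} (hN : 4 ≤ N) (hNM : N ≤ M) (hu : 0 ≤ u) :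
    -(3 / 2 * ((M - N) / (u + M))) ≤ barrierSymbol N u - barrierSymbol M u := by
  have hP : 0 < u + N := by linarith
  have hP' : 0 < u + M := by linarith
  have hN0 : 0 < N := by linarith
  have hΔ : 0 ≤ (M - N) / (u + M) := div_nonneg (by linarith) hP'.le
  have b1 : 1 / (u + M) ≤ 1 / (u + N) := one_div_le_one_div_of_le hP (by linarith)
  have b2 : 8 * N * u / (u + M) ^ 3 ≤ 8 * M * u / (u + M) ^ 3 := by gcongr
  -- Difference of cubes, grouped so that the three factors are bounded by `2`, `3` and `1/4`.
  have e1 : 8 * N * u / (u + N) ^ 3 - 8 * N * u / (u + M) ^ 3 =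
      (M - N) / (u + M) * (8 * (u * N) / (u + N) ^ 2 *
        (((u + N) ^ 2 + (u + N) * (u + M) + (u + M) ^ 2) / (u + M) ^ 2) / (u + N)) := by
    field_simp; ring
  have b3 : 8 * (u * N) / (u + N) ^ 2 ≤ 2 := by
    rw [div_le_iff₀ (by positivity)]
    linarith [mul_le_add_sq_div_four N u]
  have b4 : ((u + N) ^ 2 + (u + N) * (u + M) + (u + M) ^ 2) / (u + M) ^ 2 ≤ 3 := by
    rw [div_le_iff₀ (by positivity)]
    nlinarith
  have b5 : 8 * (u * N) / (u + N) ^ 2 *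
        (((u + N) ^ 2 + (u + N) * (u + M) + (u + M) ^ 2) / (u + M) ^ 2) / (u + N) ≤ 2 * 3 / 4 := by
    gcongr
    linarith
  have b6 := mul_le_mul_of_nonneg_left b5 hΔ
  simp only [barrierSymbol]
  linarith

/-! ### Comparison of the Anger integrals with the barriers -/

theorem angerCos_zero {n : ℕ} (hn : 1 ≤ n) : angerCos n 0 = 0 := by
  have h := mul_angerSin n 0
  have : (n : ℝ) ≠ 0 := by positivity
  simpa [this] using h.symm

theorem continuous_angerCos (n : ℕ) : Continuous (angerCos n) :=
  continuous_sinLaplace (by fun_prop)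

theorem continuous_angerSin (n : ℕ) : Continuous (angerSin n) :=
  continuous_sinLaplace (by fun_prop)

theorem tendsto_angerCos (n : ℕ) : Tendsto (angerCos n) atTop (𝓝 0) :=
  tendsto_sinLaplace_atTop (by fun_prop)

theorem barrier_zero (N : ℝ) : barrier N 0 = 0 := by simp [barrier]

theorem four_le_four_mul_sq {n : ℕ} (hn : 1 ≤ n) : (4 : ℝ) ≤ 4 * n ^ 2 := by
  have : (1 : ℝ) ≤ n := by exact_mod_cast hn
  nlinarith

theorem angerCos_le {n : ℕ} (hn : 1 ≤ n) {z : ℝ} (hz : 0 ≤ z) :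
    angerCos n z ≤ 2 * (4 * n ^ 2 / (4 * n ^ 2 - 1)) * barrier (4 * n ^ 2) z := by
  obtain ⟨f', f'', h1, h2, ode⟩ := exists_angerCos_ode n
  have hN4 := four_le_four_mul_sq hn
  set N : ℝ := 4 * n ^ 2
  have hN : 0 < N := by linarith
  -- The solution of `c(1 - 1/N) = 2`: with the worst error `z/N`, the barrier still dominates the
  -- source `2z`.
  set c : ℝ := 2 * (N / (N - 1)) with hc
  have key : (fun z => angerCos n z - c * barrier N z) z ≤ 0 := by
    refine nonpos_of_elliptic (q := fun z => z ^ 2 + N)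
      (f := fun z => angerCos n z - c * barrier N z)
      ((continuous_angerCos n).sub ((continuous_barrier hN).const_mul c)).continuousOn
      (by simp [angerCos_zero hn, barrier_zero])
      (by simpa only [sub_zero, mul_zero] using (tendsto_angerCos n).sub ((tendsto_barrier_atTop hN).const_mul c))
      (fun z _ => (h1 z).sub ((hasDerivAt_barrier hN z).const_mul c))
      (fun z _ => (h2 z).sub ((hasDerivAt_deriv_barrier hN z).const_mul c))
      (fun z _ => by positivity) (fun z hz => ?_) hz
    have e := euler_barrier hN z
    have o := ode z
    have m := mul_barrier hN z
    have b := barrierSymbol_le hN (sq_nonneg z)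
    have hcN : c * (1 - 1 / N) = 2 := by
      have : N - 1 ≠ 0 := by linarith
      rw [hc]; field_simp
    have hc0 : 0 ≤ c := by rw [hc]; exact mul_nonneg two_pos.le (div_nonneg hN.le (by linarith))
    have b' := mul_le_mul_of_nonneg_left b (mul_nonneg hc0 hz.le)
    have : c * z * (1 / N) = c * z - 2 * z := by linear_combination (-z) * hcN
    linear_combination b' + this - o + c * e - c * m
  simp only at key
  linarith

theorem le_angerCos {n : ℕ} (hn : 1 ≤ n) {z : ℝ} (hz : 0 ≤ z) :
    2 * (4 * n ^ 2 / (4 * n ^ 2 + 1)) * barrier (4 * n ^ 2) z ≤ angerCos n z := by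
  obtain ⟨f', f'', h1, h2, ode⟩ := exists_angerCos_ode n
  have hN4 := four_le_four_mul_sq hn
  set N : ℝ := 4 * n ^ 2
  have hN : 0 < N := by linarith
  set c : ℝ := 2 * (N / (N + 1)) with hc
  have key : (fun z => c * barrier N z - angerCos n z) z ≤ 0 := by
    refine nonpos_of_elliptic (q := fun z => z ^ 2 + N)
      (f := fun z => c * barrier N z - angerCos n z)
      (((continuous_barrier hN).const_mul c).sub (continuous_angerCos n)).continuousOn
      (by simp [angerCos_zero hn, barrier_zero])
      (by simpa only [sub_zero, mul_zero] using ((tendsto_barrier_atTop hN).const_mul c).sub (tendsto_angerCos n))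
      (fun z _ => ((hasDerivAt_barrier hN z).const_mul c).sub (h1 z))
      (fun z _ => ((hasDerivAt_deriv_barrier hN z).const_mul c).sub (h2 z))
      (fun z _ => by positivity) (fun z hz => ?_) hz
    have e := euler_barrier hN z
    have o := ode z
    have m := mul_barrier hN z
    have b := le_barrierSymbol hN (sq_nonneg z)
    have hcN : c * (1 + 1 / N) = 2 := by
      rw [hc]; field_simp
    have hc0 : 0 ≤ c := by rw [hc]; positivity
    have b' := mul_le_mul_of_nonneg_left b (mul_nonneg hc0 hz.le)
    have : c * z * (1 / N) = 2 * z - c * z := by linear_combination z * hcN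
    linear_combination b' + this + o - c * e + c * m
  simp only at key
  linarith

theorem sixteen_le {n : ℕ} (hn : 1 ≤ n) : (16 : ℝ) ≤ 4 * ((n + 1 : ℕ) : ℝ) ^ 2 := by
  have : (1 : ℝ) ≤ n := by exact_mod_cast hn
  push_cast; nlinarith

theorem angerCos_sub_le {n : ℕ} (hn : 1 ≤ n) {z : ℝ} (hz : 0 ≤ z) :
    angerCos n z - angerCos (n + 1) z ≤
      4 * (barrier (4 * n ^ 2) z - barrier (4 * (n + 1 : ℕ) ^ 2) z) := by
  obtain ⟨f', f'', h1, h2, ode⟩ := exists_angerCos_ode n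
  obtain ⟨g', g'', k1, k2, ode'⟩ := exists_angerCos_ode (n + 1)
  have hA : ∀ z : ℝ, 0 ≤ z → _ := fun z hz => angerCos_le (Nat.le_add_left 1 n) (z := z) hz
  have hN4 := four_le_four_mul_sq hn
  have hM16 := sixteen_le hn
  have hNM : (4 * n ^ 2 : ℝ) ≤ 4 * ((n + 1 : ℕ) : ℝ) ^ 2 := by push_cast; gcongr; linarith
  set N : ℝ := 4 * n ^ 2
  set M : ℝ := 4 * ((n + 1 : ℕ) : ℝ) ^ 2
  have hN : 0 < N := by linarith
  have hM : 0 < M := by linarith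
  have key : (fun z => (angerCos n z - angerCos (n + 1) z) - 4 * (barrier N z - barrier M z)) z
      ≤ 0 := by
    refine nonpos_of_elliptic (q := fun z => z ^ 2 + N)
      (f := fun z => (angerCos n z - angerCos (n + 1) z) - 4 * (barrier N z - barrier M z))
      (((continuous_angerCos n).sub (continuous_angerCos (n + 1))).sub
        (((continuous_barrier hN).sub (continuous_barrier hM)).const_mul 4)).continuousOn
      (by simp [angerCos_zero hn, angerCos_zero (Nat.le_add_left 1 n), barrier_zero])
      (by simpa only [sub_zero, mul_zero] using (((tendsto_angerCos n).sub (tendsto_angerCos (n + 1))).sub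
        (((tendsto_barrier_atTop hN).sub (tendsto_barrier_atTop hM)).const_mul 4)))
      (fun z _ => ((h1 z).sub (k1 z)).sub
        (((hasDerivAt_barrier hN z).sub (hasDerivAt_barrier hM z)).const_mul 4))
      (fun z _ => ((h2 z).sub (k2 z)).sub
        (((hasDerivAt_deriv_barrier hN z).sub (hasDerivAt_deriv_barrier hM z)).const_mul 4))
      (fun z _ => by positivity) (fun z hz => ?_) hz
    have e := euler_barrier hN z
    have e' := euler_barrier hM z
    have m := mul_barrier hN z
    have m' := mul_barrier hM z
    have b := mul_le_mul_of_nonneg_left (barrierSymbol_sub_le hN4 hM16 hNM (sq_nonneg z)) hz.le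
    have hw : barrier M z = z * (1 / (z ^ 2 + M)) := by rw [barrier]; ring
    have hw0 : 0 ≤ barrier M z := by rw [barrier]; positivity
    have a : angerCos (n + 1) z ≤ 32 / 15 * barrier M z := by
      refine (hA z hz.le).trans (mul_le_mul_of_nonneg_right ?_ hw0)
      have : M / (M - 1) ≤ 16 / 15 := by
        rw [div_le_div_iff₀ (by linarith) (by norm_num)]; linarith
      linarith
    have a' := mul_le_mul_of_nonneg_left a (sub_nonneg.2 hNM)
    have b' : 4 * (z * barrierSymbol N (z ^ 2) - z * barrierSymbol M (z ^ 2)) ≤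
        28 / 15 * ((M - N) * barrier M z) := by
      rw [hw]; linear_combination b
    -- In units of `(M - N) w_M` the budget closes exactly: `4 = 32/15 + 28/15`, from the bound on
    -- `angerCos (n + 1)` and from the symbol error.
    linear_combination b' + a' - ode z + ode' z + 4 * e - 4 * e' - 4 * m + 4 * m'
  simp only at key
  linarith

theorem le_angerCos_sub {n : ℕ} (hn : 1 ≤ n) {z : ℝ} (hz : 0 ≤ z) :
    1 / 2 * (barrier (4 * n ^ 2) z - barrier (4 * (n + 1 : ℕ) ^ 2) z) ≤
      angerCos n z - angerCos (n + 1) z := by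
  obtain ⟨f', f'', h1, h2, ode⟩ := exists_angerCos_ode n
  obtain ⟨g', g'', k1, k2, ode'⟩ := exists_angerCos_ode (n + 1)
  have hA : ∀ z : ℝ, 0 ≤ z → _ := fun z hz => le_angerCos (Nat.le_add_left 1 n) (z := z) hz
  have hN4 := four_le_four_mul_sq hn
  have hM16 := sixteen_le hn
  have hNM : (4 * n ^ 2 : ℝ) ≤ 4 * ((n + 1 : ℕ) : ℝ) ^ 2 := by push_cast; gcongr; linarith
  set N : ℝ := 4 * n ^ 2
  set M : ℝ := 4 * ((n + 1 : ℕ) : ℝ) ^ 2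
  have hN : 0 < N := by linarith
  have hM : 0 < M := by linarith
  have key : (fun z => 1 / 2 * (barrier N z - barrier M z) - (angerCos n z - angerCos (n + 1) z)) z
      ≤ 0 := by
    refine nonpos_of_elliptic (q := fun z => z ^ 2 + N)
      (f := fun z => 1 / 2 * (barrier N z - barrier M z) - (angerCos n z - angerCos (n + 1) z))
      ((((continuous_barrier hN).sub (continuous_barrier hM)).const_mul (1 / 2)).sub
        ((continuous_angerCos n).sub (continuous_angerCos (n + 1)))).continuousOn
      (by simp [angerCos_zero hn, angerCos_zero (Nat.le_add_left 1 n), barrier_zero])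
      (by simpa only [sub_zero, mul_zero] using (((tendsto_barrier_atTop hN).sub (tendsto_barrier_atTop hM)).const_mul
        (1 / 2)).sub ((tendsto_angerCos n).sub (tendsto_angerCos (n + 1))))
      (fun z _ => (((hasDerivAt_barrier hN z).sub (hasDerivAt_barrier hM z)).const_mul (1 / 2)).sub
        ((h1 z).sub (k1 z)))
      (fun z _ => (((hasDerivAt_deriv_barrier hN z).sub
        (hasDerivAt_deriv_barrier hM z)).const_mul (1 / 2)).sub ((h2 z).sub (k2 z)))
      (fun z _ => by positivity) (fun z hz => ?_) hz
    have e := euler_barrier hN z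
    have e' := euler_barrier hM z
    have m := mul_barrier hN z
    have m' := mul_barrier hM z
    have b := mul_le_mul_of_nonneg_left (le_barrierSymbol_sub hN4 hNM (sq_nonneg z)) hz.le
    have hw : barrier M z = z * (1 / (z ^ 2 + M)) := by rw [barrier]; ring
    have hw0 : 0 ≤ barrier M z := by rw [barrier]; positivity
    have a : 5 / 4 * barrier M z ≤ angerCos (n + 1) z := by
      refine (mul_le_mul_of_nonneg_right ?_ hw0).trans (hA z hz.le)
      have : 16 / 17 ≤ M / (M + 1) := by
        rw [div_le_div_iff₀ (by norm_num) (by linarith)]; linarith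
      linarith
    have a' := mul_le_mul_of_nonneg_left a (sub_nonneg.2 hNM)
    have b' : -(3 / 2 * ((M - N) * barrier M z)) ≤
        (z * barrierSymbol N (z ^ 2) - z * barrierSymbol M (z ^ 2)) := by
      rw [hw]; linear_combination b
    -- Here the budget is `5/4 = 1/2 + 3/4`, the last term being half of the symbol error `3/2`.
    linear_combination b' / 2 + a' + ode z - ode' z - 1 / 2 * e + 1 / 2 * e' + 1 / 2 * m - 1 / 2 * m'
  simp only at key
  linarith

/-! ### From `z` to the spectral variable: pointwise bounds on the densities -/

/-- The density of the `n`-th eigenvalue with respect to the representing measure. -/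
noncomputable def eigenDensity (b : ℝ) (n : ℕ) (x : ℝ≥0) : ℝ :=
  2 * b / n * angerSin n (2 * b * x)

/-- The comparison carries a factor `2/x`, so it is made for `x > 0`; continuity carries it to `x =
0`, where `μ` may have an atom. -/
theorem le_of_le_on_pos {f g : ℝ → ℝ} (hf : Continuous f) (hg : Continuous g)
    (h : ∀ x, 0 < x → f x ≤ g x) {x : ℝ} (hx : 0 ≤ x) : f x ≤ g x := by
  have hsub : closure (Ioi (0 : ℝ)) ⊆ {x | f x ≤ g x} :=
    (isClosed_le hf hg).closure_subset_iff.2 h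
  rw [closure_Ioi] at hsub
  exact hsub hx

theorem two_mul_div_mul_angerSin (b : ℝ) {n : ℕ} (hn : 1 ≤ n) {x : ℝ} (hx : 0 < x) :
    2 * b / n * angerSin n (2 * b * x) = 2 / x * angerCos n (2 * b * x) := by
  have h := mul_angerSin n (2 * b * x)
  have : (n : ℝ) ≠ 0 := by positivity
  field_simp
  linear_combination h / 2

theorem two_div_mul_barrier {b : ℝ} (hb : 0 < b) {n : ℕ} (hn : 1 ≤ n) {x : ℝ} (hx : 0 < x) :
    2 / x * barrier (4 * n ^ 2) (2 * b * x) = b / (n ^ 2 + (b * x) ^ 2) := by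
  have : (0 : ℝ) < n := by positivity
  rw [barrier]
  have h1 : (2 * b * x) ^ 2 + 4 * (n : ℝ) ^ 2 ≠ 0 := by positivity
  field_simp
  ring

theorem continuous_two_mul_div_mul_angerSin (b : ℝ) (n : ℕ) :
    Continuous fun x : ℝ => 2 * b / n * angerSin n (2 * b * x) :=
  continuous_const.mul ((continuous_angerSin n).comp (by fun_prop))

theorem continuous_div_sq_add {b : ℝ} {n : ℕ} (hn : 1 ≤ n) :
    Continuous fun x : ℝ => b / ((n : ℝ) ^ 2 + (b * x) ^ 2) := by
  have : (0 : ℝ) < n := by positivity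
  exact continuous_const.div (by fun_prop) fun x => by positivity

theorem le_eigenDensity {b : ℝ} (hb : 0 < b) {n : ℕ} (hn : 1 ≤ n) (x : ℝ≥0) :
    8 * (n : ℝ) ^ 2 / (4 * (n : ℝ) ^ 2 + 1) * boundDensity b n x ≤ eigenDensity b n x := by
  refine le_of_le_on_pos ((continuous_div_sq_add hn).const_mul _)
    (continuous_two_mul_div_mul_angerSin b n) (fun x hx => ?_) x.2
  have h := mul_le_mul_of_nonneg_left (le_angerCos hn (z := 2 * b * x) (by positivity))
    (by positivity : 0 ≤ 2 / x)
  rw [two_mul_div_mul_angerSin b hn hx, ← two_div_mul_barrier hb hn hx]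
  linear_combination h

theorem eigenDensity_le {b : ℝ} (hb : 0 < b) {n : ℕ} (hn : 1 ≤ n) (x : ℝ≥0) :
    eigenDensity b n x ≤ 8 * (n : ℝ) ^ 2 / (4 * (n : ℝ) ^ 2 - 1) * boundDensity b n x := by
  refine le_of_le_on_pos (continuous_two_mul_div_mul_angerSin b n)
    ((continuous_div_sq_add hn).const_mul _) (fun x hx => ?_) x.2
  have h := mul_le_mul_of_nonneg_left (angerCos_le hn (z := 2 * b * x) (by positivity))
    (by positivity : 0 ≤ 2 / x)
  rw [two_mul_div_mul_angerSin b hn hx, ← two_div_mul_barrier hb hn hx]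
  linear_combination h

theorem gapDensity_eq_sub {b : ℝ} {n : ℕ} (hn : 1 ≤ n) (x : ℝ≥0) :
    gapDensity b n x = boundDensity b n x - boundDensity b (n + 1) x := by
  have : (0 : ℝ) < n := by positivity
  have h1 : (n : ℝ) ^ 2 + (b * x) ^ 2 ≠ 0 := by positivity
  have h2 : ((n : ℝ) + 1) ^ 2 + (b * x) ^ 2 ≠ 0 := by positivity
  rw [gapDensity, boundDensity, boundDensity]
  push_cast
  field_simp
  ring

theorem gapDensity_le_eigenDensity_sub {b : ℝ} (hb : 0 < b) {n : ℕ} (hn : 1 ≤ n) (x : ℝ≥0) :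
    1 / 2 * gapDensity b n x ≤ eigenDensity b n x - eigenDensity b (n + 1) x := by
  rw [gapDensity_eq_sub hn]
  refine le_of_le_on_pos
    (((continuous_div_sq_add hn).sub (continuous_div_sq_add n.succ_pos)).const_mul _)
    ((continuous_two_mul_div_mul_angerSin b n).sub
      (continuous_two_mul_div_mul_angerSin b (n + 1))) (fun x hx => ?_) x.2
  have h := mul_le_mul_of_nonneg_left (le_angerCos_sub hn (z := 2 * b * x) (by positivity))
    (by positivity : 0 ≤ 2 / x)
  simp only [Pi.sub_apply]
  rw [two_mul_div_mul_angerSin b hn hx, two_mul_div_mul_angerSin b n.succ_pos hx,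
    ← two_div_mul_barrier hb hn hx, ← two_div_mul_barrier hb n.succ_pos hx]
  linear_combination h

theorem eigenDensity_sub_le_gapDensity {b : ℝ} (hb : 0 < b) {n : ℕ} (hn : 1 ≤ n) (x : ℝ≥0) :
    eigenDensity b n x - eigenDensity b (n + 1) x ≤ 4 * gapDensity b n x := by
  rw [gapDensity_eq_sub hn]
  refine le_of_le_on_pos ((continuous_two_mul_div_mul_angerSin b n).sub
      (continuous_two_mul_div_mul_angerSin b (n + 1)))
    (((continuous_div_sq_add hn).sub (continuous_div_sq_add n.succ_pos)).const_mul _)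
    (fun x hx => ?_) x.2
  have h := mul_le_mul_of_nonneg_left (angerCos_sub_le hn (z := 2 * b * x) (by positivity))
    (by positivity : 0 ≤ 2 / x)
  simp only [Pi.sub_apply]
  rw [two_mul_div_mul_angerSin b hn hx, two_mul_div_mul_angerSin b n.succ_pos hx,
    ← two_div_mul_barrier hb hn hx, ← two_div_mul_barrier hb n.succ_pos hx]
  linear_combination h

/-! ### Representation and integrability of the kernel -/

namespace IsLaplaceKernel

variable {K₀ : ℝ → ℝ} {μ : Measure ℝ≥0}

/-- Markov's inequality for the integrable function `e^{-x}`, which is at least `e^{-d}` on `[0,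
d]`. It yields the σ-finiteness that Fubini needs. -/
theorem measure_Iic_lt_top (h : IsLaplaceKernel K₀ μ) (d : ℝ≥0) : μ (Iic d) < ⊤ := by
  have hi := h.integrable_exp 1 one_pos
  refine (measure_mono ?_).trans_lt (hi.measure_norm_ge_lt_top (Real.exp_pos (-(1 * (d : ℝ)))))
  intro x hx
  have hx' : (x : ℝ) ≤ d := by exact_mod_cast hx
  simp only [mem_ofPred_eq, Real.norm_eq_abs, Real.abs_exp, Real.exp_le_exp]
  linarith

theorem sigmaFinite (h : IsLaplaceKernel K₀ μ) : SigmaFinite μ := by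
  have : IsLocallyFiniteMeasure μ := ⟨fun x => ⟨Iic (x + 1),
    Iic_mem_nhds (lt_add_of_pos_right x one_pos), h.measure_Iic_lt_top _⟩⟩
  infer_instance

theorem continuousOn (h : IsLaplaceKernel K₀ μ) : ContinuousOn K₀ (Ioi 0) := h.smooth.continuousOn

theorem integrable_prod (h : IsLaplaceKernel K₀ μ) {t T : ℝ} (ht : 0 < t) (htT : t ≤ T) :
    Integrable (Function.uncurry fun (r : ℝ) (x : ℝ≥0) => Real.exp (-(r * (x : ℝ))))
      ((volume.restrict (uIoc t T)).prod μ) := by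
  have := h.sigmaFinite
  have hfin : IsFiniteMeasure (volume.restrict (uIoc t T)) :=
    ⟨by rw [Measure.restrict_apply_univ, uIoc_of_le htT]; exact measure_Ioc_lt_top⟩
  have hdom : Integrable (fun p : ℝ × ℝ≥0 => Real.exp (-(t * (p.2 : ℝ))))
      ((volume.restrict (uIoc t T)).prod μ) := (h.integrable_exp t ht).comp_snd _
  refine hdom.mono' (by fun_prop : Continuous _).aestronglyMeasurable ?_
  have hprod : (volume.restrict (uIoc t T)).prod μ =
      (volume.prod μ).restrict (uIoc t T ×ˢ univ) := by
    rw [← Measure.prod_restrict, Measure.restrict_univ]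
  rw [hprod]
  refine ae_restrict_of_forall_mem (measurableSet_uIoc.prod MeasurableSet.univ) ?_
  rintro ⟨r, x⟩ ⟨hr, -⟩
  rw [uIoc_of_le htT] at hr
  simp only [Function.uncurry, Real.norm_eq_abs, Real.abs_exp, Real.exp_le_exp, neg_le_neg_iff]
  exact mul_le_mul_of_nonneg_right hr.1.le x.2

theorem sub_eq_integral (h : IsLaplaceKernel K₀ μ) {t T : ℝ} (ht : 0 < t) (htT : t ≤ T) :
    K₀ t - K₀ T = ∫ x : ℝ≥0, (∫ r in t..T, Real.exp (-(r * (x : ℝ)))) ∂μ := by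
  have := h.sigmaFinite
  have hsub : uIcc t T ⊆ Ioi 0 := by
    rw [uIcc_of_le htT]; exact fun r hr => ht.trans_le hr.1
  have hd : ∀ r ∈ uIcc t T, HasDerivAt K₀ (deriv K₀ r) r := fun r hr =>
    ((h.smooth.differentiableOn (by simp)).differentiableAt
      (isOpen_Ioi.mem_nhds (hsub hr))).hasDerivAt
  have hc : ContinuousOn (deriv K₀) (uIcc t T) :=
    (h.smooth.continuousOn_deriv_of_isOpen isOpen_Ioi (by simp)).mono hsub
  rw [← intervalIntegral_integral_swap (h.integrable_prod ht htT)]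
  rw [← neg_sub, ← intervalIntegral.integral_eq_sub_of_hasDerivAt hd hc.intervalIntegrable,
    ← intervalIntegral.integral_neg]
  exact intervalIntegral.integral_congr fun r hr => h.neg_deriv_eq r (hsub hr)

theorem integrable_intervalIntegral (h : IsLaplaceKernel K₀ μ) {t T : ℝ} (ht : 0 < t)
    (htT : t ≤ T) : Integrable (fun x : ℝ≥0 => ∫ r in t..T, Real.exp (-(r * (x : ℝ)))) μ := by
  have := h.sigmaFinite
  have := (h.integrable_prod ht htT).integral_prod_right
  simpa [intervalIntegral.integral_of_le htT, uIoc_of_le htT] using this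

theorem antitoneOn (h : IsLaplaceKernel K₀ μ) : AntitoneOn K₀ (Ioi 0) := by
  intro t ht T _ htT
  have : 0 ≤ K₀ t - K₀ T := by
    rw [h.sub_eq_integral ht htT]
    exact integral_nonneg fun x => intervalIntegral.integral_nonneg htT fun r _ => (exp_pos _).le
  linarith

theorem intervalIntegrable (h : IsLaplaceKernel K₀ μ) (h0 : IsIntegrableNearZero K₀) {T : ℝ}
    (hT : 0 < T) : IntervalIntegrable K₀ volume 0 T := by
  obtain ⟨a, ha, α, hα0, hα1, hi⟩ := h0
  have hε : 0 < min a 1 := lt_min ha one_pos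
  have h1 : IntervalIntegrable K₀ volume 0 (min a 1) := by
    rw [intervalIntegrable_iff_integrableOn_Ioo_of_le hε.le]
    refine Integrable.mono' (hi.mono_set (Ioo_subset_Ioo_right (min_le_left a 1)))
      ((h.continuousOn.mono fun r hr => hr.1).aestronglyMeasurable measurableSet_Ioo) ?_
    refine ae_restrict_of_forall_mem measurableSet_Ioo fun r hr => ?_
    rw [Real.norm_eq_abs]
    -- The exponent `-α + α²` is negative, so the weight is at least 1 on `(0, 1)`; hence the cut at
    -- `min a 1`.
    refine le_mul_of_one_le_right (abs_nonneg _)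
      (Real.one_le_rpow_of_pos_of_le_one_of_nonpos hr.1 (hr.2.le.trans (min_le_right a 1)) ?_)
    nlinarith
  refine h1.trans (ContinuousOn.intervalIntegrable (h.continuousOn.mono fun r hr => ?_))
  exact (lt_min hε hT).trans_le hr.1

/-- As `K₀` is decreasing, `K₀(2b)` bounds from below, and Jordan's inequality `sin s ≥ 2s/π` on the
first quarter period bounds from above by `K₀(4bs/π)`; the reflection `s ↦ π - s` covers the rest.
-/
theorem intervalIntegrable_sin (h : IsLaplaceKernel K₀ μ) (h0 : IsIntegrableNearZero K₀) {b : ℝ}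
    (hb : 0 < b) : IntervalIntegrable (fun s => K₀ (2 * b * Real.sin s)) volume 0 π := by
  have hπ := pi_pos
  set c : ℝ := 4 * b / π with hc
  have hc0 : 0 < c := by positivity
  have hcπ : c * π = 4 * b := by rw [hc]; field_simp
  have i1 : IntervalIntegrable (fun s => K₀ (c * s)) volume 0 π := by
    have := (h.intervalIntegrable h0 (by positivity : 0 < 4 * b)).comp_mul_left (c := c)
    convert this using 1
    · simp
    · field_simp; linarith
  have i2 : IntervalIntegrable (fun s => K₀ (c * (π - s))) volume 0 π := by
    have := (i1.comp_sub_left π).symm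
    simpa using this
  have hdom := ((intervalIntegrable_const (μ := volume) (a := 0) (b := π)
    (c := |K₀ (2 * b)|)).add i1.abs).add i2.abs
  rw [intervalIntegrable_iff_integrableOn_Ioo_of_le hπ.le] at hdom ⊢
  refine Integrable.mono' hdom (ContinuousOn.aestronglyMeasurable
    (h.continuousOn.comp (by fun_prop) fun s hs => ?_) measurableSet_Ioo) ?_
  · exact mul_pos (by positivity) (Real.sin_pos_of_mem_Ioo hs)
  refine ae_restrict_of_forall_mem measurableSet_Ioo fun s hs => ?_
  have hsin := Real.sin_pos_of_mem_Ioo hs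
  have hpos : 0 < 2 * b * Real.sin s := by positivity
  have lower : K₀ (2 * b) ≤ K₀ (2 * b * Real.sin s) :=
    h.antitoneOn hpos (mem_Ioi.2 (by positivity))
      (mul_le_of_le_one_right (by positivity) (Real.sin_le_one s))
  have step : ∀ m, 0 < m → m ≤ π / 2 → Real.sin m = Real.sin s →
      K₀ (2 * b * Real.sin s) ≤ |K₀ (c * m)| := fun m hm0 hm hms => by
    refine (h.antitoneOn (mem_Ioi.2 (mul_pos hc0 hm0)) hpos ?_).trans (le_abs_self _)
    rw [← hms]
    have := mul_le_mul_of_nonneg_left (Real.mul_le_sin hm0.le hm) (by positivity : 0 ≤ 2 * b)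
    refine le_trans (le_of_eq ?_) this
    rw [hc]; ring
  have upper : K₀ (2 * b * Real.sin s) ≤ |K₀ (c * s)| + |K₀ (c * (π - s))| := by
    rcases le_total s (π / 2) with hle | hle
    · linarith [step s hs.1 hle rfl, abs_nonneg (K₀ (c * (π - s)))]
    · linarith [step (π - s) (by linarith [hs.2]) (by linarith) (Real.sin_pi_sub s),
        abs_nonneg (K₀ (c * s))]
  rw [Real.norm_eq_abs, abs_le]
  constructor <;> linarith [neg_abs_le (K₀ (2 * b)), abs_nonneg (K₀ (2 * b)),
    abs_nonneg (K₀ (c * s)), abs_nonneg (K₀ (c * (π - s)))]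

theorem intervalIntegrable_abs_sin (h : IsLaplaceKernel K₀ μ) (h0 : IsIntegrableNearZero K₀)
    {b : ℝ} (hb : 0 < b) :
    IntervalIntegrable (fun η => K₀ (2 * b * |Real.sin (η / 2)|)) volume 0 (2 * π) := by
  have h1 : IntervalIntegrable (fun s => K₀ (2 * b * |Real.sin s|)) volume 0 π := by
    refine (h.intervalIntegrable_sin h0 hb).congr fun s hs => ?_
    rw [uIoc_of_le pi_pos.le] at hs
    simp only [abs_of_nonneg (Real.sin_nonneg_of_nonneg_of_le_pi hs.1.le hs.2)]
  have := h1.comp_mul_left (c := 2⁻¹)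
  convert this using 1
  · ext η; rw [div_eq_inv_mul]
  · simp
  · field_simp

end IsLaplaceKernel

/-! ### Integral representation of the eigenvalues -/

/-- The primitive `∫_{2b sin s}^{2b} e^{-rx} dr`. -/
noncomputable def expPrimitive (b x s : ℝ) : ℝ :=
  ∫ r in (2 * b * Real.sin s)..(2 * b), Real.exp (-(r * x))

theorem continuous_expPrimitive (b : ℝ) :
    Continuous fun p : ℝ × ℝ≥0 => expPrimitive b p.2 p.1 := by
  have : (fun p : ℝ × ℝ≥0 => expPrimitive b p.2 p.1) =
      fun p => -∫ r in (2 * b)..(2 * b * Real.sin p.1), Real.exp (-(r * (p.2 : ℝ))) := by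
    ext p; rw [expPrimitive, intervalIntegral.integral_symm]
  rw [this]
  exact (intervalIntegral.continuous_parametric_intervalIntegral_of_continuous
    (f := fun (p : ℝ × ℝ≥0) r => Real.exp (-(r * (p.2 : ℝ)))) (by fun_prop) (by fun_prop)).neg

theorem hasDerivAt_expPrimitive (b x s : ℝ) : HasDerivAt (expPrimitive b x)
    (-(2 * b * Real.cos s * Real.exp (-(2 * b * x * Real.sin s)))) s := by
  have hc : Continuous fun r : ℝ => Real.exp (-(r * x)) := by fun_prop
  have h1 := intervalIntegral.integral_hasDerivAt_left
    (hc.intervalIntegrable (2 * b * Real.sin s) (2 * b))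
    (hc.stronglyMeasurableAtFilter _ _) hc.continuousAt
  refine (h1.comp s ((Real.hasDerivAt_sin s).const_mul (2 * b))).congr_deriv ?_
  rw [show 2 * b * Real.sin s * x = 2 * b * x * Real.sin s by ring]
  ring

/-- Integration by parts against `sin(2ns)/(2n)`, which vanishes at `0` and `π`. -/
theorem integral_expPrimitive_mul_cos (b x : ℝ) {n : ℕ} (hn : 1 ≤ n) :
    ∫ s in (0 : ℝ)..π, expPrimitive b x s * Real.cos (2 * n * s) =
      b / n * angerSin n (2 * b * x) := by
  have hE : Continuous (expPrimitive b x) :=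
    continuous_iff_continuousAt.2 fun s => (hasDerivAt_expPrimitive b x s).continuousAt
  have h := intervalIntegral.integral_eq_sub_of_hasDerivAt (a := 0) (b := π)
    (f := fun s => expPrimitive b x s * Real.sin (2 * n * s))
    (fun s _ => (hasDerivAt_expPrimitive b x s).mul (hasDerivAt_sin_mul (2 * n) s))
    ((by fun_prop : Continuous _).intervalIntegrable _ _)
  rw [sin_two_nat_mul_pi] at h
  simp only [mul_zero, sub_zero, Real.sin_zero] at h
  have hn0 : (n : ℝ) ≠ 0 := by positivity
  simp only [angerSin, sinLaplace]
  rw [← intervalIntegral.integral_const_mul, ← sub_eq_zero, ← intervalIntegral.integral_sub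
      ((by fun_prop : Continuous _).intervalIntegrable _ _)
      ((by fun_prop : Continuous _).intervalIntegrable _ _),
    ← mul_eq_zero_iff_left (by positivity : (2 * n : ℝ) ≠ 0),
    ← intervalIntegral.integral_const_mul, ← h]
  congr 1; ext s
  field_simp
  ring

theorem expPrimitive_nonneg {b : ℝ} (hb : 0 < b) (x s : ℝ) : 0 ≤ expPrimitive b x s :=
  intervalIntegral.integral_nonneg
    (mul_le_of_le_one_right (by positivity) (Real.sin_le_one s)) fun r _ => (exp_pos _).le

theorem integral_cos_two_mul {n : ℕ} (hn : 1 ≤ n) :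
    ∫ s in (0 : ℝ)..π, Real.cos (2 * n * s) = 0 := by
  have hn0 : (n : ℝ) ≠ 0 := by positivity
  have h := intervalIntegral.integral_eq_sub_of_hasDerivAt (a := 0) (b := π)
    (fun s _ => hasDerivAt_sin_mul (2 * n) s)
    ((by fun_prop : Continuous _).intervalIntegrable _ _)
  rw [intervalIntegral.integral_const_mul, sin_two_nat_mul_pi] at h
  simpa [hn0] using h

theorem kernelEigenvalue_eq (K₀ : ℝ → ℝ) (b : ℝ) (n : ℕ) : kernelEigenvalue K₀ b n =
    2 * ∫ s in (0 : ℝ)..π, K₀ (2 * b * Real.sin s) * Real.cos (2 * n * s) := by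
  have h := intervalIntegral.integral_comp_div (a := 0) (b := 2 * π) (c := (2 : ℝ))
    (fun s => K₀ (2 * b * |Real.sin s|) * Real.cos (2 * n * s)) two_ne_zero
  rw [zero_div, mul_div_cancel_left₀ _ (two_ne_zero' ℝ), smul_eq_mul] at h
  refine (intervalIntegral.integral_congr fun η _ => ?_).trans (h.trans ?_)
  · congr 2; ring
  · refine congrArg (2 * ·) (intervalIntegral.integral_congr fun s hs => ?_)
    rw [uIcc_of_le pi_pos.le] at hs
    simp only [abs_of_nonneg (Real.sin_nonneg_of_nonneg_of_le_pi hs.1 hs.2)]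

namespace IsLaplaceKernel

variable {K₀ : ℝ → ℝ} {μ : Measure ℝ≥0}

/-- By nonnegativity, the inner `μ`-integral of the norm is `K₀(2b sin s) - K₀(2b)`, already known
to be integrable in `s`. -/
theorem integrable_expPrimitive (h : IsLaplaceKernel K₀ μ) (h0 : IsIntegrableNearZero K₀) {b : ℝ}
    (hb : 0 < b) : Integrable (fun p : ℝ × ℝ≥0 => expPrimitive b p.2 p.1)
      ((volume.restrict (Ioo 0 π)).prod μ) := by
  have := h.sigmaFinite
  have hle : ∀ s, 2 * b * Real.sin s ≤ 2 * b := fun s =>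
    mul_le_of_le_one_right (by positivity) (Real.sin_le_one s)
  have hpos : ∀ s ∈ Ioo (0 : ℝ) π, 0 < 2 * b * Real.sin s := fun s hs =>
    mul_pos (by positivity) (Real.sin_pos_of_mem_Ioo hs)
  rw [integrable_prod_iff (continuous_expPrimitive b).aestronglyMeasurable]
  constructor
  · exact ae_restrict_of_forall_mem measurableSet_Ioo fun s hs =>
      h.integrable_intervalIntegral (hpos s hs) (hle s)
  · have h1 := (h.intervalIntegrable_sin h0 hb).sub
      (intervalIntegrable_const (μ := volume) (a := 0) (b := π) (c := K₀ (2 * b)))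
    rw [intervalIntegrable_iff_integrableOn_Ioo_of_le pi_pos.le] at h1
    refine h1.congr (ae_restrict_of_forall_mem measurableSet_Ioo fun s hs => ?_)
    simp only [Real.norm_of_nonneg (expPrimitive_nonneg hb _ _)]
    exact h.sub_eq_integral (hpos s hs) (hle s)

theorem integrable_expPrimitive_mul_cos (h : IsLaplaceKernel K₀ μ) (h0 : IsIntegrableNearZero K₀)
    {b : ℝ} (hb : 0 < b) (n : ℕ) :
    Integrable (Function.uncurry fun (s : ℝ) (x : ℝ≥0) =>
      expPrimitive b x s * Real.cos (2 * n * s)) ((volume.restrict (uIoc 0 π)).prod μ) := by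
  rw [uIoc_of_le pi_pos.le, ← restrict_Ioo_eq_restrict_Ioc]
  refine (h.integrable_expPrimitive h0 hb).mul_bdd (c := 1)
    (by fun_prop : Continuous _).aestronglyMeasurable (Eventually.of_forall fun p => ?_)
  rw [Real.norm_eq_abs]
  exact Real.abs_cos_le_one _

theorem integrable_eigenDensity (h : IsLaplaceKernel K₀ μ) (h0 : IsIntegrableNearZero K₀)
    {b : ℝ} (hb : 0 < b) {n : ℕ} (hn : 1 ≤ n) : Integrable (eigenDensity b n) μ := by
  have := h.sigmaFinite
  refine ((h.integrable_expPrimitive_mul_cos h0 hb n).integral_prod_right.const_mul 2).congr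
    (Eventually.of_forall fun x => ?_)
  have := integral_expPrimitive_mul_cos b x hn
  rw [intervalIntegral.integral_of_le pi_pos.le, ← uIoc_of_le pi_pos.le] at this
  simp only [Function.uncurry, this, eigenDensity]
  ring

theorem kernelEigenvalue_eq_integral (h : IsLaplaceKernel K₀ μ) (h0 : IsIntegrableNearZero K₀)
    {b : ℝ} (hb : 0 < b) {n : ℕ} (hn : 1 ≤ n) :
    kernelEigenvalue K₀ b n = ∫ x, eigenDensity b n x ∂μ := by
  have := h.sigmaFinite
  have hi := h.intervalIntegrable_sin h0 hb
  have hcos : Continuous fun s : ℝ => Real.cos (2 * n * s) := by fun_prop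
  -- Subtracting the constant `K₀(2b)` is free because the cosine has mean zero for `n ≥ 1`; the
  -- difference is what `μ` represents.
  have e1 : ∫ s in (0 : ℝ)..π, K₀ (2 * b * Real.sin s) * Real.cos (2 * n * s) =
      ∫ s in (0 : ℝ)..π, (K₀ (2 * b * Real.sin s) - K₀ (2 * b)) * Real.cos (2 * n * s) := by
    simp only [sub_mul]
    rw [intervalIntegral.integral_sub (hi.mul_continuousOn hcos.continuousOn)
      ((hcos.const_mul _).intervalIntegrable _ _), intervalIntegral.integral_const_mul,
      integral_cos_two_mul hn, mul_zero, sub_zero]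
  have e2 : ∫ s in (0 : ℝ)..π, (K₀ (2 * b * Real.sin s) - K₀ (2 * b)) * Real.cos (2 * n * s) =
      ∫ s in (0 : ℝ)..π, ∫ x, expPrimitive b x s * Real.cos (2 * n * s) ∂μ := by
    rw [intervalIntegral.integral_of_le pi_pos.le, intervalIntegral.integral_of_le pi_pos.le,
      integral_Ioc_eq_integral_Ioo, integral_Ioc_eq_integral_Ioo]
    refine setIntegral_congr_fun measurableSet_Ioo fun s hs => ?_
    rw [integral_mul_const, h.sub_eq_integral
      (mul_pos (by positivity) (Real.sin_pos_of_mem_Ioo hs))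
      (mul_le_of_le_one_right (by positivity) (Real.sin_le_one s))]
    rfl
  rw [kernelEigenvalue_eq, e1, e2,
    intervalIntegral_integral_swap (h.integrable_expPrimitive_mul_cos h0 hb n),
    ← integral_const_mul]
  congr 1; ext x
  rw [integral_expPrimitive_mul_cos b x hn, eigenDensity]
  ring

end IsLaplaceKernel

/-! ### Elementary estimates for the bounding densities -/

theorem boundDensity_nonneg {b : ℝ} (hb : 0 < b) (n : ℕ) (x : ℝ≥0) : 0 ≤ boundDensity b n x := by
  rw [boundDensity]; positivity

theorem continuous_boundDensity {b : ℝ} {n : ℕ} (hn : 1 ≤ n) : Continuous (boundDensity b n) :=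
  (continuous_div_sq_add hn).comp NNReal.continuous_coe

theorem gapDensity_pos {b : ℝ} (hb : 0 < b) {n : ℕ} (hn : 1 ≤ n) (x : ℝ≥0) :
    0 < gapDensity b n x := by
  have : (0 : ℝ) < n := by positivity
  rw [gapDensity]; positivity

theorem tendsto_boundDensity (b : ℝ) (x : ℝ≥0) :
    Tendsto (fun n => boundDensity b n x) atTop (𝓝 0) :=
  tendsto_const_nhds.div_atTop (tendsto_atTop_add_const_right _ _
    ((tendsto_pow_atTop two_ne_zero).comp tendsto_natCast_atTop_atTop))

theorem le_gapDensity {b : ℝ} (hb : 0 < b) {n : ℕ} (hn : 1 ≤ n) {x d : ℝ≥0} (hx : x ≤ d) :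
    b / (2 * (1 + (b * d) ^ 2) ^ 2) / (n : ℝ) ^ 3 ≤ gapDensity b n x := by
  have hn1 : (1 : ℝ) ≤ n := by exact_mod_cast hn
  have hxd : (x : ℝ) ≤ d := by exact_mod_cast hx
  have hn2 : (1 : ℝ) ≤ (n : ℝ) ^ 2 := by nlinarith
  set Q : ℝ := 1 + (b * d) ^ 2 with hQ
  have hQ0 : 0 < Q := by positivity
  have hy : (b * (x : ℝ)) ^ 2 ≤ (b * d) ^ 2 := by gcongr
  have h1 : (n : ℝ) ^ 2 + (b * x) ^ 2 ≤ n ^ 2 * Q := by nlinarith [sq_nonneg (b * d)]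
  have h2 : ((n : ℝ) + 1) ^ 2 + (b * x) ^ 2 ≤ 4 * n ^ 2 * Q := by
    nlinarith [sq_nonneg (b * d), mul_nonneg (sub_nonneg.2 hn2) (sq_nonneg (b * d))]
  -- Uses `2n + 1 ≥ 2n` above and `n + 1 ≤ 2n` below.
  calc b / (2 * Q ^ 2) / (n : ℝ) ^ 3 = b / (n ^ 2 * Q) * ((2 * n) / (4 * n ^ 2 * Q)) := by
        field_simp; norm_num
    _ ≤ gapDensity b n x := by
        rw [gapDensity]
        gcongr
        linarith

theorem angularVelocity_eq (K₀ : ℝ → ℝ) (b : ℝ) (n : ℕ) :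
    angularVelocity K₀ b n = kernelEigenvalue K₀ b 1 - kernelEigenvalue K₀ b n := by
  simp [angularVelocity, kernelEigenvalue]

/-! ### Integration against the measure and conclusion -/

namespace IsLaplaceKernel

variable {K₀ : ℝ → ℝ} {μ : Measure ℝ≥0} {b : ℝ}

/-- No moment of `μ` is assumed: integrability is inherited from `eigenDensity`, whose lower bound
has constant at least 1. -/
theorem integrable_boundDensity (h : IsLaplaceKernel K₀ μ) (h0 : IsIntegrableNearZero K₀)
    (hb : 0 < b) {n : ℕ} (hn : 1 ≤ n) : Integrable (boundDensity b n) μ := by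
  have hc : (1 : ℝ) ≤ 8 * (n : ℝ) ^ 2 / (4 * (n : ℝ) ^ 2 + 1) := by
    rw [one_le_div (by positivity)]
    linarith [four_le_four_mul_sq hn]
  refine (h.integrable_eigenDensity h0 hb hn).mono'
    (continuous_boundDensity hn).aestronglyMeasurable (Eventually.of_forall fun x => ?_)
  rw [Real.norm_of_nonneg (boundDensity_nonneg hb n x)]
  exact (le_mul_of_one_le_left (boundDensity_nonneg hb n x) hc).trans (le_eigenDensity hb hn x)

theorem integrable_gapDensity (h : IsLaplaceKernel K₀ μ) (h0 : IsIntegrableNearZero K₀)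
    (hb : 0 < b) {n : ℕ} (hn : 1 ≤ n) : Integrable (gapDensity b n) μ :=
  ((h.integrable_boundDensity h0 hb hn).sub (h.integrable_boundDensity h0 hb n.succ_pos)).congr
    (Eventually.of_forall fun x => (gapDensity_eq_sub hn x).symm)

theorem kernelEigenvalue_le (h : IsLaplaceKernel K₀ μ) (h0 : IsIntegrableNearZero K₀)
    (hb : 0 < b) {n : ℕ} (hn : 1 ≤ n) : kernelEigenvalue K₀ b n ≤
      8 * (n : ℝ) ^ 2 / (4 * (n : ℝ) ^ 2 - 1) * ∫ x, boundDensity b n x ∂μ := by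
  rw [h.kernelEigenvalue_eq_integral h0 hb hn, ← integral_const_mul]
  exact integral_mono (h.integrable_eigenDensity h0 hb hn)
    ((h.integrable_boundDensity h0 hb hn).const_mul _) (eigenDensity_le hb hn)

theorem le_kernelEigenvalue (h : IsLaplaceKernel K₀ μ) (h0 : IsIntegrableNearZero K₀)
    (hb : 0 < b) {n : ℕ} (hn : 1 ≤ n) :
    8 * (n : ℝ) ^ 2 / (4 * (n : ℝ) ^ 2 + 1) * ∫ x, boundDensity b n x ∂μ ≤
      kernelEigenvalue K₀ b n := by
  rw [h.kernelEigenvalue_eq_integral h0 hb hn, ← integral_const_mul]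
  exact integral_mono ((h.integrable_boundDensity h0 hb hn).const_mul _)
    (h.integrable_eigenDensity h0 hb hn) (le_eigenDensity hb hn)

theorem angularVelocity_sub (h : IsLaplaceKernel K₀ μ) (h0 : IsIntegrableNearZero K₀)
    (hb : 0 < b) {n : ℕ} (hn : 1 ≤ n) : angularVelocity K₀ b (n + 1) - angularVelocity K₀ b n =
      ∫ x, (eigenDensity b n x - eigenDensity b (n + 1) x) ∂μ := by
  rw [integral_sub (h.integrable_eigenDensity h0 hb hn)
    (h.integrable_eigenDensity h0 hb n.succ_pos), ← h.kernelEigenvalue_eq_integral h0 hb hn,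
    ← h.kernelEigenvalue_eq_integral h0 hb n.succ_pos, angularVelocity_eq, angularVelocity_eq]
  ring

theorem gapIntegral_le (h : IsLaplaceKernel K₀ μ) (h0 : IsIntegrableNearZero K₀)
    (hb : 0 < b) {n : ℕ} (hn : 1 ≤ n) :
    1 / 2 * gapIntegral μ b n ≤ angularVelocity K₀ b (n + 1) - angularVelocity K₀ b n := by
  rw [h.angularVelocity_sub h0 hb hn, gapIntegral, ← integral_const_mul]
  exact integral_mono ((h.integrable_gapDensity h0 hb hn).const_mul _)
    ((h.integrable_eigenDensity h0 hb hn).sub (h.integrable_eigenDensity h0 hb n.succ_pos))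
    (gapDensity_le_eigenDensity_sub hb hn)

theorem le_gapIntegral (h : IsLaplaceKernel K₀ μ) (h0 : IsIntegrableNearZero K₀)
    (hb : 0 < b) {n : ℕ} (hn : 1 ≤ n) :
    angularVelocity K₀ b (n + 1) - angularVelocity K₀ b n ≤ 4 * gapIntegral μ b n := by
  rw [h.angularVelocity_sub h0 hb hn, gapIntegral, ← integral_const_mul]
  exact integral_mono
    ((h.integrable_eigenDensity h0 hb hn).sub (h.integrable_eigenDensity h0 hb n.succ_pos))
    ((h.integrable_gapDensity h0 hb hn).const_mul _) (eigenDensity_sub_le_gapDensity hb hn)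

theorem gapIntegral_pos (h : IsLaplaceKernel K₀ μ) (h0 : IsIntegrableNearZero K₀)
    (hb : 0 < b) {n : ℕ} (hn : 1 ≤ n) : 0 < gapIntegral μ b n := by
  rw [gapIntegral, integral_pos_iff_support_of_nonneg (fun x => (gapDensity_pos hb hn x).le)
    (h.integrable_gapDensity h0 hb hn)]
  have : Function.support (gapDensity b n) = univ :=
    eq_univ_of_forall fun x => (gapDensity_pos hb hn x).ne'
  rw [this, Measure.measure_univ_pos]
  exact h.measure_ne_zero

theorem tendsto_integral_boundDensity (h : IsLaplaceKernel K₀ μ) (h0 : IsIntegrableNearZero K₀)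
    (hb : 0 < b) : Tendsto (fun n => ∫ x, boundDensity b n x ∂μ) atTop (𝓝 0) := by
  have ht : Tendsto (fun n => ∫ x, boundDensity b n x ∂μ) atTop (𝓝 (∫ _, (0 : ℝ) ∂μ)) := by
    refine tendsto_integral_filter_of_dominated_convergence (boundDensity b 1) ?_ ?_
      (h.integrable_boundDensity h0 hb le_rfl)
      (Eventually.of_forall fun x => tendsto_boundDensity b x)
    · filter_upwards [eventually_ge_atTop 1] with n hn
      exact (continuous_boundDensity hn).aestronglyMeasurable
    · filter_upwards [eventually_ge_atTop 1] with n hn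
      refine Eventually.of_forall fun x => ?_
      rw [Real.norm_of_nonneg (boundDensity_nonneg hb n x), boundDensity, boundDensity]
      gcongr
  simpa using ht

theorem tendsto_kernelEigenvalue (h : IsLaplaceKernel K₀ μ) (h0 : IsIntegrableNearZero K₀)
    (hb : 0 < b) : Tendsto (kernelEigenvalue K₀ b) atTop (𝓝 0) := by
  -- `8/3` is the largest value of `8n²/(4n² - 1)`, attained at `n = 1`.
  have ht := (h.tendsto_integral_boundDensity h0 hb).const_mul (8 / 3)
  rw [mul_zero] at ht
  have hB : ∀ n, 0 ≤ ∫ x, boundDensity b n x ∂μ := fun n =>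
    integral_nonneg (boundDensity_nonneg hb n)
  refine squeeze_zero' ?_ ?_ ht
  · filter_upwards [eventually_ge_atTop 1] with n hn
    exact (mul_nonneg (by positivity) (hB n)).trans (h.le_kernelEigenvalue h0 hb hn)
  · filter_upwards [eventually_ge_atTop 1] with n hn
    refine (h.kernelEigenvalue_le h0 hb hn).trans (mul_le_mul_of_nonneg_right ?_ (hB n))
    have := four_le_four_mul_sq hn
    rw [div_le_div_iff₀ (by linarith) (by norm_num)]
    linarith

theorem le_angularVelocity_sub (h : IsLaplaceKernel K₀ μ) (h0 : IsIntegrableNearZero K₀)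
    (hb : 0 < b) {d : ℝ≥0} {m : ℝ} (hm : ENNReal.ofReal m ≤ μ (Iic d)) {n : ℕ} (hn : 1 ≤ n) :
    m * (b / (4 * (1 + (b * d) ^ 2) ^ 2)) / (n : ℝ) ^ 3 ≤
      angularVelocity K₀ b (n + 1) - angularVelocity K₀ b n := by
  have hfin := (h.measure_Iic_lt_top d).ne
  have hm' : m ≤ μ.real (Iic d) := (ENNReal.ofReal_le_iff_le_toReal hfin).1 hm
  set c : ℝ := b / (2 * (1 + (b * d) ^ 2) ^ 2) / (n : ℝ) ^ 3 with hc
  have hc0 : 0 ≤ c := by positivity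
  have key : m * c ≤ gapIntegral μ b n :=
    calc m * c ≤ μ.real (Iic d) * c := by gcongr
      _ = ∫ _ in Iic d, c ∂μ := by rw [setIntegral_const, smul_eq_mul]
      _ ≤ ∫ x in Iic d, gapDensity b n x ∂μ :=
          setIntegral_mono_on (integrableOn_const hfin)
            (h.integrable_gapDensity h0 hb hn).integrableOn measurableSet_Iic
            fun x hx => le_gapDensity hb hn hx
      _ ≤ gapIntegral μ b n := setIntegral_le_integral (h.integrable_gapDensity h0 hb hn)
          (Eventually.of_forall fun x => (gapDensity_pos hb hn x).le)
  refine le_trans (le_of_eq ?_)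
    ((mul_le_mul_of_nonneg_left key one_half_pos.le).trans (h.gapIntegral_le h0 hb hn))
  rw [hc]
  field_simp
  norm_num

theorem exists_measure_Iic_pos (h : IsLaplaceKernel K₀ μ) : ∃ d : ℝ≥0, 0 < μ (Iic d) := by
  by_contra! hd
  refine h.measure_ne_zero (Measure.measure_univ_eq_zero.1 ?_)
  have : (univ : Set ℝ≥0) = ⋃ k : ℕ, Iic (k : ℝ≥0) := by
    ext x
    simpa using exists_nat_ge x
  rw [this]
  exact measure_iUnion_null fun k => le_antisymm (hd k) zero_le

end IsLaplaceKernel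

theorem lemma4p2 (b : ℝ) (hb : 0 < b) :
    (∀ (K₀ : ℝ → ℝ) (μ : Measure ℝ≥0), IsLaplaceKernel K₀ μ → IsIntegrableNearZero K₀ →
      IntervalIntegrable (fun η : ℝ => K₀ (2 * b * |Real.sin (η / 2)|)) volume 0 (2 * π) ∧
      (∀ n : ℕ, 1 ≤ n →
        Integrable (boundDensity b n) μ ∧
        kernelEigenvalue K₀ b 1 -
            8 * (n : ℝ) ^ 2 / (4 * (n : ℝ) ^ 2 - 1) * ∫ x : ℝ≥0, boundDensity b n x ∂μ
          ≤ angularVelocity K₀ b n ∧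
        angularVelocity K₀ b n
          ≤ kernelEigenvalue K₀ b 1 -
            8 * (n : ℝ) ^ 2 / (4 * (n : ℝ) ^ 2 + 1) * ∫ x : ℝ≥0, boundDensity b n x ∂μ) ∧
      Tendsto (fun n : ℕ => angularVelocity K₀ b n) atTop
        (𝓝 (∫ η in (0 : ℝ)..(2 * π), K₀ (2 * b * |Real.sin (η / 2)|) * Real.cos η)) ∧
      StrictMonoOn (fun n : ℕ => angularVelocity K₀ b n) (Ici 1) ∧
      (∀ n : ℕ, 1 ≤ n →
        Integrable (gapDensity b n) μ ∧
        1 / 2 * gapIntegral μ b n ≤ angularVelocity K₀ b (n + 1) - angularVelocity K₀ b n ∧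
        angularVelocity K₀ b (n + 1) - angularVelocity K₀ b n ≤ 4 * gapIntegral μ b n) ∧
      ∃ c : ℝ, 0 < c ∧ ∀ n : ℕ, 1 ≤ n →
        c / (n : ℝ) ^ 3 ≤ angularVelocity K₀ b (n + 1) - angularVelocity K₀ b n) ∧
    (∀ (d : ℝ≥0) (m : ℝ), 0 < m → ∃ c : ℝ, 0 < c ∧
      ∀ (K₀ : ℝ → ℝ) (μ : Measure ℝ≥0), IsLaplaceKernel K₀ μ → IsIntegrableNearZero K₀ →
        ENNReal.ofReal m ≤ μ (Iic d) →
        ∀ n : ℕ, 1 ≤ n →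
          c / (n : ℝ) ^ 3 ≤ angularVelocity K₀ b (n + 1) - angularVelocity K₀ b n) := by

  constructor
  · intro K₀ μ h h0
    have gap : ∀ n : ℕ, 1 ≤ n → 0 < angularVelocity K₀ b (n + 1) - angularVelocity K₀ b n :=
      fun n hn => (mul_pos one_half_pos (h.gapIntegral_pos h0 hb hn)).trans_le
        (h.gapIntegral_le h0 hb hn)
    refine ⟨h.intervalIntegrable_abs_sin h0 hb, fun n hn =>
      ⟨h.integrable_boundDensity h0 hb hn, ?_, ?_⟩, ?_, ?_, fun n hn =>
      ⟨h.integrable_gapDensity h0 hb hn, h.gapIntegral_le h0 hb hn, h.le_gapIntegral h0 hb hn⟩, ?_⟩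
    · rw [angularVelocity_eq]
      linarith [h.kernelEigenvalue_le h0 hb hn]
    · rw [angularVelocity_eq]
      linarith [h.le_kernelEigenvalue h0 hb hn]
    · rw [← sub_zero (∫ η in (0 : ℝ)..(2 * π), K₀ (2 * b * |Real.sin (η / 2)|) * Real.cos η)]
      exact tendsto_const_nhds.sub (h.tendsto_kernelEigenvalue h0 hb)
    · exact strictMonoOn_of_lt_add_one ordConnected_Ici fun n _ hn _ => sub_pos.1 (gap n hn)
    · obtain ⟨d, hd⟩ := h.exists_measure_Iic_pos
      have hfin := (h.measure_Iic_lt_top d).ne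
      have hm : 0 < μ.real (Iic d) := ENNReal.toReal_pos hd.ne' hfin
      exact ⟨μ.real (Iic d) * (b / (4 * (1 + (b * d) ^ 2) ^ 2)), by positivity, fun n hn =>
        h.le_angularVelocity_sub h0 hb ENNReal.ofReal_toReal_le hn⟩
  · intro d m hm
    exact ⟨m * (b / (4 * (1 + (b * d) ^ 2) ^ 2)), by positivity, fun K₀ μ h h0 hμ n hn =>
      h.le_angularVelocity_sub h0 hb hμ hn⟩
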